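/- Let $(\Omega,\mu)$ be a probability space; all subsets of $\Omega$ below are measurable. Let $\Gamma$ be a digraphon on $\Omega$, that is, a measurable function $\Gamma:\Omega^2\to[0,1]$ (not necessarily symmetric). Let $X\subseteq\Omega$ have positive measure. We say that $X$ is *strongly connected* in $\Gamma$ if for every partition $X=A\sqcup B$ with $\mu(A),\mu(B)>0$ we have $\int_{A\times B}\Gamma>0$. We say that $X$ is a *strong component* in $\Gamma$ if $X$ is strongly connected and no $Y\subseteq\Omega$ with $\mu(X\cap Y)>0$ and $\mu(Y\setminus X)>0$ is strongly connected. We say that $X$ is *fragmented* in $\Gamma$ if no subset $Y\subseteq X$ of positive measure is strongly connected. Theorem 2.2. There exist a finite or countable set $I$ not containing $0$ (possibly empty) and a decomposition $\Omega=X_0\sqcup\bigsqcup_{i\in I}X_i$ such that $X_0$ is either empty or fragmented in $\Gamma$, and each $X_i$ ($i\in I$) is a strong component in $\Gamma$. Further, this decomposition is unique in the following sense: if $\{X_i\}_{i\in I\cup\{0\}}$ and $\{X'_i\}_{i\in I'\cup\{0\}}$ are two such decompositions, then there exists a bijection $\pi:I\to I'$ such that $X'_{\pi(i)}$ equals $X_i$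 modulo a nullset for each $i\in I$, and $X_0$ equals $X'_0$ modulo a nullset. -/

import Mathlib

open MeasureTheory

/-- A digraphon on a measurable space `Ω`: a measurable function `Ω × Ω → [0,1]`, where `Ω × Ω`
carries the product sigma-algebra. No symmetry is required. -/
structure Digraphon (Ω : Type*) [MeasurableSpace Ω] where
  /-- The underlying function. -/
  toFun : Ω × Ω → ℝ
  measurable' : Measurable toFun
  mem_Icc' : ∀ p, toFun p ∈ Set.Icc (0 : ℝ) 1

namespace Digraphon

variable {Ω : Type*} [MeasurableSpace Ω]

/-- The integral of `Γ` over the rectangle `A × B`. -/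
noncomputable def rectIntegral (Γ : Digraphon Ω) (μ : Measure Ω) (A B : Set Ω) : ℝ :=
  ∫ p in A ×ˢ B, Γ.toFun p ∂(μ.prod μ)

/-- A measurable set `X` of positive measure is strongly connected in `Γ` if for every partition
of `X` into measurable sets `A`, `B` of positive measure, the integral of `Γ` over `A × B` is
positive. -/
structure IsStronglyConnected (Γ : Digraphon Ω) (μ : Measure Ω) (X : Set Ω) : Prop where
  measurableSet : MeasurableSet X
  measure_pos : 0 < μ X
  rectIntegral_pos : ∀ A B : Set Ω, MeasurableSet A → MeasurableSet B → Disjoint A B →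
    A ∪ B = X → 0 < μ A → 0 < μ B → 0 < Γ.rectIntegral μ A B

/-- A strongly connected set `X` is a strong component of `Γ` if no measurable set `Y` with
`μ (X ∩ Y) > 0` and `μ (Y \ X) > 0` is strongly connected. -/
structure IsStrongComponent (Γ : Digraphon Ω) (μ : Measure Ω) (X : Set Ω) : Prop where
  isStronglyConnected : Γ.IsStronglyConnected μ X
  not_isStronglyConnected : ∀ Y : Set Ω, MeasurableSet Y → 0 < μ (X ∩ Y) → 0 < μ (Y \ X) →
    ¬ Γ.IsStronglyConnected μ Y

/-- A measurable set `X` of positive measure is fragmented in `Γ` if no measurable subset of `X`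
of positive measure is strongly connected. -/
structure IsFragmented (Γ : Digraphon Ω) (μ : Measure Ω) (X : Set Ω) : Prop where
  measurableSet : MeasurableSet X
  measure_pos : 0 < μ X
  not_isStronglyConnected : ∀ Y : Set Ω, MeasurableSet Y → Y ⊆ X → 0 < μ Y →
    ¬ Γ.IsStronglyConnected μ Y

/-- `Ω` is the disjoint union of `X₀` and of the sets `X i`, where `i` ranges over a finite or
countable index type, `X₀` is empty or fragmented, and each `X i` is a strong component. -/
structure IsStrongDecomposition (Γ : Digraphon Ω) (μ : Measure Ω) {ι : Type*}
    (X₀ : Set Ω) (X : ι → Set Ω) : Prop where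
  countable : Countable ι
  disjoint_left : ∀ i, Disjoint X₀ (X i)
  pairwise_disjoint : ∀ i j, i ≠ j → Disjoint (X i) (X j)
  union_eq : X₀ ∪ ⋃ i, X i = Set.univ
  eq_empty_or_isFragmented : X₀ = ∅ ∨ Γ.IsFragmented μ X₀
  isStrongComponent : ∀ i, Γ.IsStrongComponent μ (X i)

end Digraphon

namespace Digraphon

variable {Ω : Type*} [MeasurableSpace Ω] {μ : Measure Ω} {Γ : Digraphon Ω}

/-! Strong connectedness survives countable unions of sets that all meet one of them in positive
measure (`union_iUnion`). Hence a union of nearly largest strongly connected sets meeting `X` is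
maximal, so `X` lies in a strong component (`exists_isStrongComponent`). Components overlapping in
positive measure agree a.e., so their a.e. classes are countably many, and what they leave over
contains no strongly connected set. Uniqueness holds because every component must occur, up to a
nullset, in every decomposition (`exists_ae_eq`). -/

theorem IsStrongComponent.measurableSet {X : Set Ω} (hX : Γ.IsStrongComponent μ X) :
    MeasurableSet X :=
  hX.isStronglyConnected.measurableSet

theorem IsStrongComponent.measure_pos {X : Set Ω} (hX : Γ.IsStrongComponent μ X) : 0 < μ X :=
  hX.isStronglyConnected.measure_pos

theorem IsStrongComponent.ae_le {X Y : Set Ω} (hX : Γ.IsStrongComponent μ X)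
    (hY : Γ.IsStronglyConnected μ Y) (h : 0 < μ (X ∩ Y)) : Y ≤ᵐ[μ] X := by
  rw [ae_le_set]
  by_contra h'
  exact hX.not_isStronglyConnected Y hY.measurableSet h (pos_iff_ne_zero.mpr h') hY

theorem IsStrongComponent.ae_eq {X Y : Set Ω} (hX : Γ.IsStrongComponent μ X)
    (hY : Γ.IsStrongComponent μ Y) (h : 0 < μ (X ∩ Y)) : X =ᵐ[μ] Y :=
  (hY.ae_le hX.isStronglyConnected (Set.inter_comm X Y ▸ h)).antisymm
    (hX.ae_le hY.isStronglyConnected h)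

theorem IsStrongDecomposition.eq_compl {ι : Type*} {X₀ : Set Ω}
    {X : ι → Set Ω} (h : Γ.IsStrongDecomposition μ X₀ X) : X₀ = (⋃ i, X i)ᶜ :=
  IsCompl.eq_compl ⟨Set.disjoint_iUnion_right.mpr h.disjoint_left,
    codisjoint_iff.mpr h.union_eq⟩

theorem IsStrongDecomposition.eq_of_ae_eq {ι : Type*} {X₀ : Set Ω}
    {X : ι → Set Ω} (h : Γ.IsStrongDecomposition μ X₀ X) {i j : ι}
    (hij : X i =ᵐ[μ] X j) : i = j := by
  by_contra hne
  have h₁ : (X i ∩ X j : Set Ω) =ᵐ[μ] (X j ∩ X j : Set Ω) := hij.inter (ae_eq_refl (X j))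
  rw [(h.pairwise_disjoint i j hne).inter_eq, Set.inter_self] at h₁
  exact (h.isStrongComponent j).measure_pos.ne' (by rw [← measure_congr h₁, measure_empty])

variable [IsProbabilityMeasure μ]

theorem integrable (Γ : Digraphon Ω) (μ : Measure Ω) [IsProbabilityMeasure μ] :
    Integrable Γ.toFun (μ.prod μ) := by
  refine Integrable.of_bound Γ.measurable'.aestronglyMeasurable 1 (ae_of_all _ fun p => ?_)
  rw [Real.norm_eq_abs, abs_of_nonneg (Γ.mem_Icc' p).1]
  exact (Γ.mem_Icc' p).2

theorem rectIntegral_mono_ae {A B A' B' : Set Ω} (hA : A ≤ᵐ[μ] A') (hB : B ≤ᵐ[μ] B') :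
    Γ.rectIntegral μ A B ≤ Γ.rectIntegral μ A' B' := by
  refine setIntegral_mono_set (Γ.integrable μ).integrableOn
    (ae_of_all _ fun p => (Γ.mem_Icc' p).1) ?_
  have h₁ := (Measure.quasiMeasurePreserving_fst (μ := μ) (ν := μ)).ae hA
  have h₂ := (Measure.quasiMeasurePreserving_snd (μ := μ) (ν := μ)).ae hB
  filter_upwards [h₁, h₂] with p hp₁ hp₂ hp
  exact ⟨hp₁ hp.1, hp₂ hp.2⟩

/-- A strongly connected set meeting both parts of an almost everywhere cover forces a positive
integral between the parts. -/
theorem IsStronglyConnected.rectIntegral_pos_of_inter {Y A B : Set Ω}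
    (hY : Γ.IsStronglyConnected μ Y) (hA : MeasurableSet A)
    (hAB : Y ≤ᵐ[μ] (A ∪ B : Set Ω)) (hYA : 0 < μ (Y ∩ A)) (hYB : 0 < μ (Y \ A)) :
    0 < Γ.rectIntegral μ A B := by
  refine (hY.rectIntegral_pos (Y ∩ A) (Y \ A) (hY.measurableSet.inter hA)
    (hY.measurableSet.diff hA) (Set.disjoint_sdiff_right.mono_left Set.inter_subset_right)
    (Set.inter_union_sdiff Y A) hYA hYB).trans_le (rectIntegral_mono_ae ?_ ?_)
  · exact Set.inter_subset_right.eventuallyLE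
  · filter_upwards [hAB] with x hx hxY
    exact (hx hxY.1).resolve_left hxY.2

theorem IsStronglyConnected.congr {X Y : Set Ω} (hX : Γ.IsStronglyConnected μ X)
    (hY : MeasurableSet Y) (h : X =ᵐ[μ] Y) : Γ.IsStronglyConnected μ Y := by
  refine ⟨hY, measure_congr h ▸ hX.measure_pos, fun A B hA hB hAB hU hpA hpB => ?_⟩
  refine hX.rectIntegral_pos_of_inter hA (hU ▸ h.le) ?_ ?_
  · have : (X ∩ A : Set Ω) =ᵐ[μ] (Y ∩ A : Set Ω) := h.inter (ae_eq_refl A)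
    rw [measure_congr this]
    exact hpA.trans_le (measure_mono fun x hx => ⟨hU ▸ Or.inl hx, hx⟩)
  · have : (X \ A : Set Ω) =ᵐ[μ] (Y \ A : Set Ω) := h.diff (ae_eq_refl A)
    rw [measure_congr this]
    exact hpB.trans_le (measure_mono fun x hx =>
      ⟨hU ▸ Or.inr hx, fun hxA => Set.disjoint_left.mp hAB hxA hx⟩)

/-- A countable union of strongly connected sets that all meet a fixed strongly connected set is
strongly connected together with that set. -/
theorem IsStronglyConnected.union_iUnion {ι : Type*} [Countable ι] {X : Set Ω} {Y : ι → Set Ω}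
    (hX : Γ.IsStronglyConnected μ X) (hY : ∀ i, Γ.IsStronglyConnected μ (Y i))
    (hXY : ∀ i, 0 < μ (X ∩ Y i)) : Γ.IsStronglyConnected μ (X ∪ ⋃ i, Y i) := by
  refine ⟨hX.measurableSet.union (MeasurableSet.iUnion fun i => (hY i).measurableSet),
    hX.measure_pos.trans_le (measure_mono Set.subset_union_left),
    fun A B hA hB hAB hU hpA hpB => ?_⟩
  by_contra hneg
  have key : ∀ Z : Set Ω, Γ.IsStronglyConnected μ Z → Z ⊆ A ∪ B →
      μ (Z ∩ A) = 0 ∨ μ (Z ∩ B) = 0 := by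
    intro Z hZ hZU
    by_contra! h
    refine hneg (hZ.rectIntegral_pos_of_inter hA hZU.eventuallyLE (pos_iff_ne_zero.mpr h.1)
      ((pos_iff_ne_zero.mpr h.2).trans_le (measure_mono fun x hx =>
        ⟨hx.1, fun hxA => Set.disjoint_left.mp hAB hxA hx.2⟩)))
  have hXU : X ⊆ A ∪ B := hU ▸ Set.subset_union_left
  have hYU : ∀ i, Y i ⊆ A ∪ B := fun i =>
    hU ▸ (Set.subset_iUnion Y i).trans Set.subset_union_right
  -- If `X` has null part in `D`, then no `Y i` has null part in `C`, as it shares positive measure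
  -- with `X`; so each is null in `D`.
  have absorb : ∀ C D : Set Ω, A ∪ B = C ∪ D → μ (X ∩ D) = 0 →
      (∀ i, μ (Y i ∩ C) = 0 ∨ μ (Y i ∩ D) = 0) → μ D = 0 := by
    intro C D hCD hXD hor
    refine measure_mono_null (t := (X ∩ D) ∪ ⋃ i, Y i ∩ D) (fun x hx => ?_)
      (measure_union_null hXD (measure_iUnion_null fun i => ?_))
    · have hx' : x ∈ X ∪ ⋃ i, Y i := hU ▸ hCD ▸ Or.inr hx
      rw [← Set.iUnion_inter, ← Set.union_inter_distrib_right]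
      exact ⟨hx', hx⟩
    · refine (hor i).resolve_left fun h => (hXY i).ne' ?_
      refine measure_mono_null (t := (Y i ∩ C) ∪ (X ∩ D)) (fun x hx => ?_)
        (measure_union_null h hXD)
      exact (hCD ▸ hXU hx.1 : x ∈ C ∪ D).imp (fun h => ⟨hx.2, h⟩) (fun h => ⟨hx.1, h⟩)
  rcases key X hX hXU with h | h
  · exact hpA.ne' (absorb B A (Set.union_comm A B) h fun i => (key _ (hY i) (hYU i)).symm)
  · exact hpB.ne' (absorb A B rfl h fun i => key _ (hY i) (hYU i))

theorem IsStrongComponent.congr {X Y : Set Ω} (hX : Γ.IsStrongComponent μ X)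
    (hY : MeasurableSet Y) (h : X =ᵐ[μ] Y) : Γ.IsStrongComponent μ Y := by
  refine ⟨hX.isStronglyConnected.congr hY h, fun Z hZ h₁ h₂ =>
    hX.not_isStronglyConnected Z hZ ?_ ?_⟩
  · have : (X ∩ Z : Set Ω) =ᵐ[μ] (Y ∩ Z : Set Ω) := h.inter (ae_eq_refl Z)
    rwa [measure_congr this]
  · have : (Z \ X : Set Ω) =ᵐ[μ] (Z \ Y : Set Ω) := (ae_eq_refl Z).diff h
    rwa [measure_congr this]

/-- Every strongly connected set is contained in a strong component. -/
theorem IsStronglyConnected.exists_isStrongComponent {X : Set Ω}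
    (hX : Γ.IsStronglyConnected μ X) : ∃ Z, Γ.IsStrongComponent μ Z ∧ X ⊆ Z := by
  let S : Set ENNReal := {r | ∃ Y, Γ.IsStronglyConnected μ Y ∧ 0 < μ (X ∩ Y) ∧ μ Y = r}
  have hS : S.Nonempty := ⟨μ X, X, hX, by simpa using hX.measure_pos, rfl⟩
  obtain ⟨u, -, hu, huS⟩ := exists_seq_tendsto_sSup hS (OrderTop.bddAbove S)
  choose Y hY hXY hYu using huS
  let Z := X ∪ ⋃ n, Y n
  have hZ : Γ.IsStronglyConnected μ Z := hX.union_iUnion hY hXY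
  have hle : sSup S ≤ μ Z := le_of_tendsto' hu fun n =>
    hYu n ▸ measure_mono ((Set.subset_iUnion Y n).trans Set.subset_union_right)
  refine ⟨Z, ⟨hZ, fun W hW h₁ h₂ hWc => ?_⟩, Set.subset_union_left⟩
  have hZW : Γ.IsStronglyConnected μ (Z ∪ W) := by
    have h := hZ.union_iUnion (Y := fun _ : Unit => W) (fun _ => hWc) (fun _ => h₁)
    rwa [Set.iUnion_const] at h
  have hmem : μ (Z ∪ W) ∈ S := by
    refine ⟨_, hZW, hX.measure_pos.trans_le (measure_mono fun x hx => ?_), rfl⟩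
    exact ⟨hx, Or.inl (Or.inl hx)⟩
  -- `Z` attains the supremum and `Z ∪ W` competes for it, yet `W` would add positive measure.
  have h₃ : μ (Z ∪ W) ≤ μ Z := (le_sSup hmem).trans hle
  rw [← Set.union_sdiff_self, measure_union Set.disjoint_sdiff_right
    (hW.diff hZ.measurableSet)] at h₃
  exact (ENNReal.lt_add_right (measure_ne_top μ Z) h₂.ne').not_ge h₃

theorem exists_isStrongDecomposition (Γ : Digraphon Ω) (μ : Measure Ω) [IsProbabilityMeasure μ] :
    ∃ (ι : Type) (X₀ : Set Ω) (X : ι → Set Ω), Γ.IsStrongDecomposition μ X₀ X := by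
  classical
  let s : Setoid {X : Set Ω // Γ.IsStrongComponent μ X} :=
    ⟨fun X Y => X.1 =ᵐ[μ] Y.1, fun _ => ae_eq_refl _, fun h => h.symm, fun h h' => h.trans h'⟩
  let R : Quotient s → Set Ω := fun q => q.out.1
  have hR : ∀ q, Γ.IsStrongComponent μ (R q) := fun q => q.out.2
  have hdisj : Pairwise (Function.onFun (AEDisjoint μ) R) := by
    intro p q hpq
    by_contra h
    refine hpq ?_
    rw [← p.out_eq, ← q.out_eq]
    exact Quotient.sound ((hR p).ae_eq (hR q) (pos_iff_ne_zero.mpr h))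
  have hcount : Countable (Quotient s) := by
    have := Measure.countable_meas_pos_of_disjoint_iUnion₀ (μ := μ)
      (fun q => (hR q).measurableSet.nullMeasurableSet) hdisj
    rw [← Set.countable_univ_iff]
    exact this.mono fun q _ => (hR q).measure_pos
  -- The quotient lives in the universe of `Ω`; indexing by a subset of `ℕ` brings it down to
  -- `Type`.
  obtain ⟨f, hf⟩ := hcount.exists_injective_nat
  let e : Quotient s ≃ Set.range f := Equiv.ofInjective f hf
  obtain ⟨t, htm, ht0, htd⟩ := exists_null_pairwise_disjoint_sdiff hdisj
  let V : Set.range f → Set Ω := fun i => R (e.symm i) \ t (e.symm i)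
  have hVm : ∀ i, MeasurableSet (V i) := fun i => (hR _).measurableSet.diff (htm _)
  have hVR : ∀ i, R (e.symm i) =ᵐ[μ] V i := fun i => (sdiff_null_ae_eq_self (ht0 _)).symm
  have hV : ∀ i, Γ.IsStrongComponent μ (V i) := fun i => (hR _).congr (hVm i) (hVR i)
  have hVd : ∀ i j, i ≠ j → Disjoint (V i) (V j) := fun i j hij =>
    htd (e.symm.injective.ne hij)
  let N : Set Ω := (⋃ i, V i)ᶜ
  have hNm : MeasurableSet N := (MeasurableSet.iUnion hVm).compl
  have hNV : ∀ i, Disjoint N (V i) := fun i =>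
    Set.disjoint_compl_left_iff_subset.mpr (Set.subset_iUnion V i)
  have hNU : N ∪ ⋃ i, V i = Set.univ := Set.compl_union_self _
  -- A nullset is not fragmented, so a null remainder is absorbed into one component, which exists
  -- since `Ω` itself is not null.
  by_cases hN : μ N = 0
  · have hne : Nonempty (Set.range f) := by
      by_contra h
      rw [not_nonempty_iff] at h
      simp [N] at hN
    obtain ⟨i₀⟩ := hne
    let W : Set.range f → Set Ω := fun i => if i = i₀ then V i ∪ N else V i
    have hVW : ∀ i, V i ⊆ W i := fun i => by
      by_cases h : i = i₀
      · simp [W, h]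
      · simp [W, h]
    refine ⟨Set.range f, ∅, W, inferInstance, fun i => Set.empty_disjoint _, fun i j hij => ?_, ?_,
      Or.inl rfl, fun i => ?_⟩
    · by_cases hi : i = i₀
      · have hj : j ≠ i₀ := fun hj => hij (hi.trans hj.symm)
        simp only [W, if_pos hi, if_neg hj]
        exact (hVd i j hij).union_left (hNV j)
      · by_cases hj : j = i₀
        · simp only [W, if_neg hi, if_pos hj]
          exact (hVd i j hij).union_right (hNV i).symm
        · simpa only [W, if_neg hi, if_neg hj] using hVd i j hij
    · rw [Set.empty_union, Set.eq_univ_iff_forall]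
      intro x
      rcases (hNU ▸ Set.mem_univ x : x ∈ N ∪ ⋃ i, V i) with h | h
      · exact Set.mem_iUnion.mpr ⟨i₀, by simp [W, h]⟩
      · exact Set.iUnion_mono hVW h
    · by_cases hi : i = i₀
      · simp only [W, if_pos hi]
        exact (hV i).congr ((hVm i).union hNm) (union_ae_eq_left_of_ae_eq_empty
          (ae_eq_empty.mpr hN)).symm
      · simpa only [W, if_neg hi] using hV i
  · refine ⟨Set.range f, N, V, inferInstance, hNV, hVd, hNU, Or.inr ⟨hNm, pos_iff_ne_zero.mpr hN,
      fun Y hYm hYN hY0 hY => ?_⟩, hV⟩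
    obtain ⟨Z, hZ, hYZ⟩ := hY.exists_isStrongComponent
    let q : Quotient s := ⟦⟨Z, hZ⟩⟧
    have h₁ : R q =ᵐ[μ] Z := Quotient.mk_out (s := s) ⟨Z, hZ⟩
    have h₂ : R q =ᵐ[μ] V (e q) := by simpa using hVR (e q)
    have h₃ : (Y ∩ V (e q) : Set Ω) =ᵐ[μ] (Y ∩ Z : Set Ω) :=
      (ae_eq_refl Y).inter (h₂.symm.trans h₁)
    rw [Set.inter_eq_left.mpr hYZ, ((hNV (e q)).mono_left hYN).inter_eq] at h₃
    exact hY0.ne' (by rw [← measure_congr h₃, measure_empty])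

namespace IsStrongDecomposition

variable {ι κ : Type*} {X₀ X₀' : Set Ω} {X : ι → Set Ω} {X' : κ → Set Ω}

/-- Otherwise `Y` would lie a.e. in `X₀`, which is empty or fragmented. -/
theorem exists_ae_eq (h : Γ.IsStrongDecomposition μ X₀ X) {Y : Set Ω}
    (hY : Γ.IsStrongComponent μ Y) : ∃ i, X i =ᵐ[μ] Y := by
  have := h.countable
  by_cases hpos : ∃ i, 0 < μ (X i ∩ Y)
  · obtain ⟨i, hi⟩ := hpos
    exact ⟨i, (h.isStrongComponent i).ae_eq hY hi⟩
  · exfalso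
    simp only [not_exists, not_lt, nonpos_iff_eq_zero] at hpos
    have hdiff : μ (Y \ X₀) = 0 := by
      rw [h.eq_compl, Set.sdiff_compl, Set.inter_comm, Set.iUnion_inter]
      exact measure_iUnion_null hpos
    have hX₀m : MeasurableSet X₀ := h.eq_compl ▸
      (MeasurableSet.iUnion fun i => (h.isStrongComponent i).measurableSet).compl
    have heq : Y =ᵐ[μ] (Y ∩ X₀ : Set Ω) := by
      filter_upwards [ae_le_set.mpr hdiff] with x hx
      exact propext ⟨fun hxY => ⟨hxY, hx hxY⟩, fun hx' => hx'.1⟩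
    have hc := hY.isStronglyConnected.congr (hY.measurableSet.inter hX₀m) heq
    rcases h.eq_empty_or_isFragmented with h₀ | h₀
    · exact hc.measure_pos.ne' (by simp [h₀])
    · exact h₀.not_isStronglyConnected _ hc.measurableSet Set.inter_subset_right hc.measure_pos hc

theorem exists_equiv (h : Γ.IsStrongDecomposition μ X₀ X)
    (h' : Γ.IsStrongDecomposition μ X₀' X') :
    ∃ π : ι ≃ κ, (∀ i, X' (π i) =ᵐ[μ] X i) ∧ X₀ =ᵐ[μ] X₀' := by
  choose f hf using fun i => h'.exists_ae_eq (h.isStrongComponent i)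
  choose g hg using fun j => h.exists_ae_eq (h'.isStrongComponent j)
  let π : ι ≃ κ := ⟨f, g, fun i => h.eq_of_ae_eq ((hg _).trans (hf i)),
    fun j => h'.eq_of_ae_eq ((hf _).trans (hg j))⟩
  refine ⟨π, hf, ?_⟩
  have := h.countable
  have hU : (⋃ i, X i : Set Ω) =ᵐ[μ] (⋃ j, X' j : Set Ω) := by
    rw [← π.surjective.iUnion_comp X']
    exact Filter.EventuallyEq.countable_iUnion fun i => (hf i).symm
  rw [h.eq_compl, h'.eq_compl]
  exact hU.compl

end IsStrongDecomposition

end Digraphon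

theorem theorem2p2 {Ω : Type*} [MeasurableSpace Ω] (μ : Measure Ω)
    [IsProbabilityMeasure μ] (Γ : Digraphon Ω) :
    (∃ (ι : Type) (X₀ : Set Ω) (X : ι → Set Ω), Γ.IsStrongDecomposition μ X₀ X) ∧
    (∀ (ι : Type*) (κ : Type*) (X₀ X₀' : Set Ω) (X : ι → Set Ω) (X' : κ → Set Ω),
      Γ.IsStrongDecomposition μ X₀ X → Γ.IsStrongDecomposition μ X₀' X' →
      ∃ π : ι ≃ κ, (∀ i, X' (π i) =ᵐ[μ] X i) ∧ X₀ =ᵐ[μ] X₀') :=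
  ⟨Γ.exists_isStrongDecomposition μ, fun _ _ _ _ _ _ h h' => h.exists_equiv h'⟩
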